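/- Let $D$ be a division ring containing $\mathbb{Q}$ in its centre with $\dim_{\mathbb{Q}} D < \infty$. An order in $D$ is a subring (with $1$) whose additive group is finitely generated and which spans $D$ over $\mathbb{Q}$; a maximal order is an order not contained in any larger order. Let $R$ be a maximal order in $D$, and let $G$ be a left $R$-module containing a submodule isomorphic to $R^{(\mathbb{N})} = \bigoplus_{n \in \mathbb{N}} R$, the free left $R$-module of countably infinite rank. Let $M \subseteq N$ be finitely generated $R$-submodules of $G$ which are torsion-free, i.e. $\alpha x \neq 0$ for all non-zero $\alpha \in R$ and all non-zero $x$ in the submodule. Then there exists a finitely generated free $R$-submodule $F \subseteq G$ such that $F \cap N = M$. -/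

import Mathlib

/-- A subring `R` (with the same `1`) of a `ℚ`-algebra `D` is an *order* in `D` if its additive
group is finitely generated and `ℚ R = D`. It is meant for finite-dimensional `D`. -/
structure Subring.IsOrder {D : Type*} [Ring D] [Algebra ℚ D] (R : Subring D) : Prop where
  fg : R.toAddSubgroup.FG
  span_eq_top : Submodule.span ℚ (R : Set D) = ⊤

/-- A *maximal order* in `D` is an order in `D` that is not contained in any larger order. -/
def Subring.IsMaximalOrder {D : Type*} [Ring D] [Algebra ℚ D] (R : Subring D) : Prop :=
  R.IsOrder ∧ ∀ S : Subring D, S.IsOrder → R ≤ S → S = R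

/-! If `M` is projective, it is a retract of some `R^k` through `s : R^k → M` and `i : M → R^k`. Map
`R^k` to `G` by `s` plus a free, `N`-avoiding copy of the complementary part `v - i (s v)`. This map
is injective and its range meets `N` exactly in `M`; the copy exists because `N` involves only
finitely many coordinates of `R^(ℕ)`.

Projectivity of `M` (`projective_of_smul_ne_zero`) is the main work. Multiplication by an integer
embeds `M` with finite index in a free module, and one descends through simple finite quotients `S`.
Each `S` is a summand of `R ⧸ Ann S`, so Schanuel's lemma reduces everything to projectivity of `Q =
Ann S`. There the classical argument for invertibility of maximal two-sided ideals applies: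
multiplier rings of ideals equal `R`, and `Q⁻¹ ⊄ R`. -/

/-! ### Schanuel's lemma and kernels onto retracts of cyclic modules. -/

theorem Module.Projective.of_schanuel {R L P X : Type*} [Ring R] [AddCommGroup L] [Module R L]
    [AddCommGroup P] [Module R P] [AddCommGroup X] [Module R X] [Module.Projective R L]
    [Module.Projective R P] (f : L →ₗ[R] X) (g : P →ₗ[R] X) (hf : Function.Surjective f)
    (hg : Function.Surjective g) [Module.Projective R (LinearMap.ker g)] :
    Module.Projective R (LinearMap.ker f) := by
  obtain ⟨u, hu⟩ := Module.projective_lifting_property g f hg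
  obtain ⟨v, hv⟩ := Module.projective_lifting_property f g hf
  have hu' : ∀ x, g (u x) = f x := fun x => LinearMap.congr_fun hu x
  have hv' : ∀ x, f (v x) = g x := fun x => LinearMap.congr_fun hv x
  -- the splitting `ker f → L × ker g → ker f`
  let i : LinearMap.ker f →ₗ[R] L × LinearMap.ker g :=
    LinearMap.prod (LinearMap.ker f).subtype
      ((u.comp (LinearMap.ker f).subtype).codRestrict _ fun x => by simp [hu'])
  let s : L × LinearMap.ker g →ₗ[R] LinearMap.ker f :=
    LinearMap.codRestrict _ (LinearMap.coprod (LinearMap.id - v.comp u)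
      (v.comp (LinearMap.ker g).subtype)) fun x => by simp [hu', hv']
  refine Module.Projective.of_split i s ?_
  ext x
  change ((x : L) - v (u x)) + v (u x) = x
  abel

/-- The factor `R` added to `L` covers the complement of `S` in `R ⧸ Q`, so `L × R` maps onto `R ⧸
Q` and Schanuel applies. Since `p ∘ g` is `f` on the first coordinate, `ker f` is a retract of `ker
g`. -/
theorem Module.Projective.ker_of_retract {R L S : Type*} [Ring R] [AddCommGroup L] [Module R L]
    [AddCommGroup S] [Module R S] [Module.Projective R L] (f : L →ₗ[R] S)
    (hf : Function.Surjective f) (Q : Submodule R R) [Module.Projective R Q]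
    (p : (R ⧸ Q) →ₗ[R] S) (t : S →ₗ[R] (R ⧸ Q)) (hpt : p ∘ₗ t = LinearMap.id) :
    Module.Projective R (LinearMap.ker f) := by
  have hpt' : ∀ x, p (t x) = x := fun x => LinearMap.congr_fun hpt x
  let g : L × R →ₗ[R] (R ⧸ Q) :=
    LinearMap.coprod (t.comp f) ((LinearMap.id - t.comp p).comp Q.mkQ)
  have hg : Function.Surjective g := fun y => by
    obtain ⟨l, hl⟩ := hf (p y)
    obtain ⟨r, hr⟩ := Q.mkQ_surjective y
    exact ⟨(l, r), by simp only [g, LinearMap.coprod_apply, LinearMap.comp_apply, hl, hr]; simp⟩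
  have : Module.Projective R (LinearMap.ker Q.mkQ) := by rwa [Submodule.ker_mkQ]
  have : Module.Projective R (LinearMap.ker g) :=
    Module.Projective.of_schanuel g Q.mkQ hg Q.mkQ_surjective
  have hpg : ∀ x : L × R, p (g x) = f x.1 := fun x => by simp [g, hpt']
  let i : LinearMap.ker f →ₗ[R] LinearMap.ker g :=
    LinearMap.codRestrict _ ((LinearMap.inl R L R).comp (LinearMap.ker f).subtype)
      fun x => by simp [g]
  let s : LinearMap.ker g →ₗ[R] LinearMap.ker f :=
    LinearMap.codRestrict _ ((LinearMap.fst R L R).comp (LinearMap.ker g).subtype) fun x => by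
      have := hpg x
      rw [LinearMap.mem_ker.1 x.2, map_zero] at this
      simpa using this.symm
  refine Module.Projective.of_split i s ?_
  ext x
  rfl

/-! ### Annihilators of finite simple modules. -/

section Annihilator

variable {R S : Type*} [Ring R] [AddCommGroup S] [Module R S]

theorem Module.exists_injective_quotient_annihilator (R S : Type*) [Ring R] [AddCommGroup S]
    [Module R S] :
    ∃ f : (R ⧸ Module.annihilator R S) →ₗ[R] (S → S), Function.Injective f ∧
      ∀ r s, f (Submodule.Quotient.mk r) s = r • s := by
  refine ⟨(Module.annihilator R S).liftQ (LinearMap.pi fun s => LinearMap.toSpanSingleton R S s)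
    fun r hr => ?_, ?_, fun r s => rfl⟩
  · rw [LinearMap.mem_ker]
    ext s
    simpa using Module.mem_annihilator.1 hr s
  · rw [← LinearMap.ker_eq_bot, Submodule.ker_liftQ_eq_bot]
    intro r hr
    exact Module.mem_annihilator.2 fun s => by simpa using congrFun (LinearMap.mem_ker.1 hr) s

/-- Acting on all elements of `S` embeds the quotient in a finite power of `S`. -/
theorem Module.isSemisimpleModule_quotient_annihilator [Finite S] [IsSimpleModule R S] :
    IsSemisimpleModule R (R ⧸ Module.annihilator R S) := by
  obtain ⟨f, hf, -⟩ := Module.exists_injective_quotient_annihilator R S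
  exact IsSemisimpleModule.of_injective f hf

theorem LinearMap.exists_rightInverse_of_isSemisimpleModule {M : Type*} [AddCommGroup M]
    [Module R M] [IsSemisimpleModule R M] (f : M →ₗ[R] S) (hf : Function.Surjective f) :
    ∃ t : S →ₗ[R] M, f ∘ₗ t = LinearMap.id := by
  have : IsSemisimpleModule R S := IsSemisimpleModule.of_surjective f hf
  exact IsSemisimpleModule.lifting_property f hf LinearMap.id

theorem Module.exists_retract_quotient_annihilator [Finite S] [IsSimpleModule R S] :
    ∃ (p : (R ⧸ Module.annihilator R S) →ₗ[R] S) (t : S →ₗ[R] (R ⧸ Module.annihilator R S)),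
      p ∘ₗ t = LinearMap.id := by
  have := Module.isSemisimpleModule_quotient_annihilator (R := R) (S := S)
  have := IsSimpleModule.nontrivial R S
  obtain ⟨s, hs⟩ := exists_ne (0 : S)
  have hle : Module.annihilator R S ≤ LinearMap.ker (LinearMap.toSpanSingleton R S s) :=
    fun r hr => by simpa using Module.mem_annihilator.1 hr s
  refine ⟨(Module.annihilator R S).liftQ _ hle,
    LinearMap.exists_rightInverse_of_isSemisimpleModule _ fun x => ?_⟩
  obtain ⟨r, hr⟩ := IsSimpleModule.toSpanSingleton_surjective R hs x
  exact ⟨Submodule.Quotient.mk r, hr⟩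

/-- Annihilators of finite simple modules are maximal among annihilators of simple modules. -/
theorem Module.annihilator_eq_of_le {S' : Type*} [AddCommGroup S'] [Module R S'] [Finite S]
    [IsSimpleModule R S] [IsSimpleModule R S']
    (h : Module.annihilator R S ≤ Module.annihilator R S') :
    Module.annihilator R S = Module.annihilator R S' := by
  have := Module.isSemisimpleModule_quotient_annihilator (R := R) (S := S)
  have := IsSimpleModule.nontrivial R S'
  obtain ⟨s, hs⟩ := exists_ne (0 : S')
  have hle : Module.annihilator R S ≤ LinearMap.ker (LinearMap.toSpanSingleton R S' s) :=
    fun r hr => by simpa using Module.mem_annihilator.1 (h hr) s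
  obtain ⟨t, ht⟩ := LinearMap.exists_rightInverse_of_isSemisimpleModule
    ((Module.annihilator R S).liftQ _ hle) fun x => by
      obtain ⟨r, hr⟩ := IsSimpleModule.toSpanSingleton_surjective R hs x
      exact ⟨Submodule.Quotient.mk r, hr⟩
  -- `S'` embeds through `t` in a power of `S`; some coordinate is nonzero and, by Schur, an
  -- isomorphism.
  obtain ⟨f, hf, -⟩ := Module.exists_injective_quotient_annihilator R S
  have hts : t s ≠ 0 := fun h0 => hs <| by
    have := LinearMap.congr_fun ht s
    simpa [h0] using this.symm
  obtain ⟨x, hx⟩ : ∃ x, f (t s) x ≠ 0 := by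
    by_contra! hc
    exact hts ((map_eq_zero_iff f hf).1 (funext hc))
  have hne : (LinearMap.proj x ∘ₗ f ∘ₗ t : S' →ₗ[R] S) ≠ 0 := fun h0 =>
    hx (LinearMap.congr_fun h0 s)
  exact (LinearEquiv.ofBijective _ (LinearMap.bijective_of_ne_zero hne)).annihilator_eq.symm

end Annihilator

/-- If submodules of `L` that are covered by a projective submodule with finite quotient are
projective, then so are all submodules of finite index of `L`, if `L` is projective. -/
theorem Module.Projective.of_finite_quotient {R : Type*} {L : Type*} [Ring R] [AddCommGroup L]
    [Module R L]
    (h : ∀ A B : Submodule R L, Module.Projective R A → B ⋖ A →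
      Finite (A ⧸ B.submoduleOf A) → Module.Projective R B)
    [Module.Projective R L] (M : Submodule R L) [hfin : Finite (L ⧸ M)] :
    Module.Projective R M := by
  have hfinI : ∀ A B : Submodule R L, M ≤ B → Finite (A ⧸ B.submoduleOf A) := fun A B hMB => by
    have : Finite (L ⧸ B) := _root_.Finite.of_surjective _ (Submodule.factor_surjective hMB)
    refine _root_.Finite.of_injective
      ((B.submoduleOf A).mapQ B A.subtype (by rw [Submodule.submoduleOf])) ?_
    rw [← LinearMap.ker_eq_bot, Submodule.mapQ, Submodule.ker_liftQ_eq_bot]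
    intro x hx
    exact (by simpa using hx : (x : L) ∈ B)
  have hfinite : (Set.Ici M).Finite := by
    refine Set.Finite.of_finite_image (f := fun N => (Submodule.map M.mkQ N : Set (L ⧸ M)))
      (Set.toFinite _) ?_
    intro A hA B hB hAB
    have := congrArg (Submodule.comap M.mkQ) (SetLike.coe_injective hAB)
    rwa [Submodule.comap_map_mkQ, Submodule.comap_map_mkQ, sup_eq_right.2 hA,
      sup_eq_right.2 hB] at this
  -- a minimal projective submodule containing `M`
  obtain ⟨A, ⟨hMA, hA⟩, hmin⟩ := Set.Finite.exists_minimal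
    (s := {A : Submodule R L | M ≤ A ∧ Module.Projective R A})
    (hfinite.subset fun A hA => hA.1)
    ⟨⊤, le_top, Module.Projective.of_equiv Submodule.topEquiv.symm⟩
  rcases hMA.eq_or_lt with rfl | hlt
  · exact hA
  obtain ⟨B, ⟨hMB, hBA⟩, hBmax⟩ := Set.Finite.exists_maximal
    (s := {B : Submodule R L | M ≤ B ∧ B < A}) (hfinite.subset fun A hA => hA.1)
    ⟨M, le_rfl, hlt⟩
  have hcov : B ⋖ A := ⟨hBA, fun C hBC hCA => hBC.not_ge (hBmax ⟨hMB.trans hBC.le, hCA⟩ hBC.le)⟩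
  exact absurd (hmin ⟨hMB, h A B hA hcov (hfinI A B hMB)⟩ hBA.le) hBA.not_ge

/-- Over a ring whose finite simple modules have projective annihilators, submodules of finite
index of projective modules are projective. -/
theorem Module.Projective.of_finite_quotient_of_annihilator {R L : Type*} [Ring R]
    [AddCommGroup L] [Module R L]
    (h : ∀ m : Ideal R, IsCoatom m → Finite (R ⧸ m) →
      Module.Projective R (Module.annihilator R (R ⧸ m)))
    [Module.Projective R L] (M : Submodule R L) [Finite (L ⧸ M)] : Module.Projective R M := by
  refine Module.Projective.of_finite_quotient (fun A B hA hBA hfin => ?_) M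
  have hS : IsSimpleModule R (A ⧸ B.submoduleOf A) := (covBy_iff_quot_is_simple hBA.le).1 hBA
  obtain ⟨m, hm, ⟨e⟩⟩ := isSimpleModule_iff_quot_maximal.1 hS
  have hQ : Module.Projective R (Module.annihilator R (A ⧸ B.submoduleOf A)) := by
    rw [e.annihilator_eq]
    exact h m hm.out (Finite.of_equiv _ e.toEquiv)
  obtain ⟨p, t, hpt⟩ := Module.exists_retract_quotient_annihilator (R := R)
    (S := A ⧸ B.submoduleOf A)
  have := Module.Projective.ker_of_retract (B.submoduleOf A).mkQ (Submodule.mkQ_surjective _)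
    _ p t hpt
  rw [Submodule.ker_mkQ] at this
  exact Module.Projective.of_equiv (Submodule.submoduleOfEquivOfLe hBA.le)


/-! ### Products of ideals as lattices in `D`, and the dual basis criterion. -/

namespace Subring

section Lattice

variable {D : Type*} [Ring D] (R : Subring D)

/-- A left ideal of a subring of `D`, as an additive subgroup of `D`. -/
def idealLattice (P : Ideal R) : Submodule ℤ D :=
  AddSubgroup.toIntSubmodule (P.toAddSubgroup.map R.subtype.toAddMonoidHom)

variable {R}

theorem mem_idealLattice {P : Ideal R} {x : D} :
    x ∈ R.idealLattice P ↔ ∃ h : x ∈ R, (⟨x, h⟩ : R) ∈ P := by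
  constructor
  · rintro ⟨r, hr, rfl⟩
    exact ⟨r.2, hr⟩
  · rintro ⟨h, hx⟩
    exact ⟨_, hx, rfl⟩

theorem coe_mem_idealLattice {P : Ideal R} {r : R} : (r : D) ∈ R.idealLattice P ↔ r ∈ P := by
  simp [mem_idealLattice]

theorem mul_mem_idealLattice {P : Ideal R} {r x : D} (hr : r ∈ R) (hx : x ∈ R.idealLattice P) :
    r * x ∈ R.idealLattice P := by
  obtain ⟨h, hx⟩ := mem_idealLattice.1 hx
  exact mem_idealLattice.2 ⟨R.mul_mem hr h, P.mul_mem_left ⟨r, hr⟩ hx⟩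

theorem idealLattice_mul_mem {P : Ideal R} [P.IsTwoSided] {r x : D} (hx : x ∈ R.idealLattice P)
    (hr : r ∈ R) : x * r ∈ R.idealLattice P := by
  obtain ⟨h, hx⟩ := mem_idealLattice.1 hx
  exact mem_idealLattice.2 ⟨R.mul_mem h hr, P.mul_mem_right ⟨r, hr⟩ hx⟩

variable (R) in
/-- The product of a list of left ideals of a subring of `D`, as an additive subgroup of `D`. -/
def idealProd (l : List (Ideal R)) : Submodule ℤ D :=
  l.foldr (fun P I => R.idealLattice P * I) (R.idealLattice ⊤)

theorem mem_idealProd_nil {x : D} : x ∈ R.idealProd [] ↔ x ∈ R := by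
  change x ∈ R.idealLattice ⊤ ↔ _
  simp [mem_idealLattice]

theorem idealProd_cons (P : Ideal R) (l : List (Ideal R)) :
    R.idealProd (P :: l) = R.idealLattice P * R.idealProd l := rfl

theorem mul_mem_idealProd {l : List (Ideal R)} {r x : D} (hr : r ∈ R) (hx : x ∈ R.idealProd l) :
    r * x ∈ R.idealProd l := by
  cases l with
  | nil => exact mem_idealProd_nil.2 (R.mul_mem hr (mem_idealProd_nil.1 hx))
  | cons P l =>
    rw [idealProd_cons] at hx ⊢
    induction hx using Submodule.mul_induction_on' with
    | mem_mul_mem p hp y hy =>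
      rw [← mul_assoc]
      exact Submodule.mul_mem_mul (mul_mem_idealLattice hr hp) hy
    | add x _ y _ hx hy =>
      rw [mul_add]
      exact add_mem hx hy

/-- One-sided ideals suffice because the product ends in a factor `R`. -/
theorem idealProd_mul_mem {l : List (Ideal R)} {r x : D} (hx : x ∈ R.idealProd l) (hr : r ∈ R) :
    x * r ∈ R.idealProd l := by
  induction l generalizing x with
  | nil => exact mem_idealProd_nil.2 (R.mul_mem (mem_idealProd_nil.1 hx) hr)
  | cons P l ih =>
    rw [idealProd_cons] at hx ⊢
    induction hx using Submodule.mul_induction_on' with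
    | mem_mul_mem p hp y hy =>
      rw [mul_assoc]
      exact Submodule.mul_mem_mul hp (ih hy)
    | add x _ y _ hx hy =>
      rw [add_mul]
      exact add_mem hx hy

theorem idealProd_le (l : List (Ideal R)) {x : D} (hx : x ∈ R.idealProd l) : x ∈ R := by
  induction l generalizing x with
  | nil => exact mem_idealProd_nil.1 hx
  | cons P l ih =>
    rw [idealProd_cons] at hx
    induction hx using Submodule.mul_induction_on' with
    | mem_mul_mem p hp y hy => exact R.mul_mem (mem_idealLattice.1 hp).1 (ih hy)
    | add x _ y _ hx hy => exact R.add_mem hx hy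

theorem idealProd_append (l l' : List (Ideal R)) :
    R.idealProd (l ++ l') = R.idealProd l * R.idealProd l' := by
  induction l with
  | nil =>
    apply le_antisymm
    · intro x hx
      rw [← one_mul x]
      exact Submodule.mul_mem_mul (mem_idealProd_nil.2 R.one_mem) hx
    · exact Submodule.mul_le.2 fun r hr x hx => mul_mem_idealProd (mem_idealProd_nil.1 hr) hx
  | cons P l ih => rw [List.cons_append, idealProd_cons, idealProd_cons, ih, mul_assoc]

theorem exists_int_mem_idealProd [CharZero D] [NoZeroDivisors D] (l : List (Ideal R))
    (hl : ∀ P ∈ l, ∃ n : ℤ, n ≠ 0 ∧ (n : R) ∈ P) : ∃ n : ℤ, n ≠ 0 ∧ (n : D) ∈ R.idealProd l := by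
  induction l with
  | nil => exact ⟨1, one_ne_zero, mem_idealProd_nil.2 (by simp)⟩
  | cons P l ih =>
    obtain ⟨n, hn, hnP⟩ := hl P (by simp)
    obtain ⟨k, hk, hkl⟩ := ih fun Q hQ => hl Q (by simp [hQ])
    refine ⟨n * k, mul_ne_zero hn hk, ?_⟩
    rw [idealProd_cons, Int.cast_mul]
    exact Submodule.mul_mem_mul (by simpa using coe_mem_idealLattice.2 hnP) hkl

/-- An ideal that is the annihilator of a finite simple module. -/
def IsFinitePrimitive (P : Ideal R) : Prop :=
  ∃ m : Ideal R, IsCoatom m ∧ Finite (R ⧸ m) ∧ P = Module.annihilator R (R ⧸ m)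

theorem IsFinitePrimitive.isTwoSided {P : Ideal R} (hP : IsFinitePrimitive P) :
    P.IsTwoSided := by
  obtain ⟨m, -, -, rfl⟩ := hP
  infer_instance

theorem IsFinitePrimitive.exists_int_mem {P : Ideal R} (hP : IsFinitePrimitive P) :
    ∃ n : ℤ, n ≠ 0 ∧ (n : R) ∈ P := by
  obtain ⟨m, -, hfin, rfl⟩ := hP
  refine ⟨Nat.card (R ⧸ m), by exact_mod_cast Nat.card_pos.ne', ?_⟩
  rw [Module.mem_annihilator]
  intro x
  rw [Int.cast_smul_eq_zsmul, natCast_zsmul]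
  exact card_nsmul_eq_zero'

theorem IsFinitePrimitive.eq_of_le {P Q : Ideal R} (hP : IsFinitePrimitive P)
    {m : Ideal R} (hm : IsCoatom m) (hQ : Q = Module.annihilator R (R ⧸ m)) (h : P ≤ Q) :
    P = Q := by
  obtain ⟨m', hm', hfin, rfl⟩ := hP
  subst hQ
  have := isSimpleModule_iff_isCoatom.2 hm
  have := isSimpleModule_iff_isCoatom.2 hm'
  exact Module.annihilator_eq_of_le h

/-- Annihilators of simple modules are prime: if `y • s ≠ 0` and `p • s' ≠ 0`, simplicity gives `s'
= r • y • s`, so `p * r * y` does not kill `s`. -/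
theorem IsFinitePrimitive.exists_mem_le {Q : Ideal R} (hQ : IsFinitePrimitive Q)
    (l : List (Ideal R)) (hl : R.idealProd l ≤ R.idealLattice Q) : ∃ P ∈ l, P ≤ Q := by
  obtain ⟨m, hm, -, hQ⟩ := hQ
  have := isSimpleModule_iff_isCoatom.2 hm
  have := IsSimpleModule.nontrivial R (R ⧸ m)
  induction l with
  | nil =>
    have h1 := coe_mem_idealLattice.1 (hl (mem_idealProd_nil.2 R.one_mem) : ((1 : R) : D) ∈ _)
    obtain ⟨s, hs⟩ := exists_ne (0 : R ⧸ m)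
    rw [hQ, Module.mem_annihilator] at h1
    exact absurd (by simpa only [one_smul] using h1 s) hs
  | cons P l ih =>
    by_cases hPQ : P ≤ Q
    · exact ⟨P, by simp, hPQ⟩
    by_cases hlQ : R.idealProd l ≤ R.idealLattice Q
    · obtain ⟨P', hP', h⟩ := ih hlQ
      exact ⟨P', by simp [hP'], h⟩
    exfalso
    obtain ⟨p, hp, hpQ⟩ := SetLike.not_le_iff_exists.1 hPQ
    obtain ⟨y, hy, hyQ⟩ := SetLike.not_le_iff_exists.1 hlQ
    lift y to R using idealProd_le l hy
    rw [coe_mem_idealLattice, hQ, Module.mem_annihilator] at hyQ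
    rw [hQ, Module.mem_annihilator] at hpQ
    push Not at hyQ hpQ
    obtain ⟨s, hs⟩ := hyQ
    obtain ⟨s', hs'⟩ := hpQ
    obtain ⟨r, rfl⟩ := IsSimpleModule.toSpanSingleton_surjective R hs s'
    have hmem : ((p * (r * y) : R) : D) ∈ R.idealProd (P :: l) := by
      rw [idealProd_cons]
      exact Submodule.mul_mem_mul (coe_mem_idealLattice.2 hp) (mul_mem_idealProd r.2 hy)
    have := coe_mem_idealLattice.1 (hl hmem)
    rw [hQ, Module.mem_annihilator] at this
    apply hs'
    simpa [mul_smul] using this s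

/-- A finite module is killed by a product of annihilators of finite simple modules. -/
theorem exists_idealProd_smul_eq_zero (k : ℕ) (M : Type*) [AddCommGroup M] [Module R M] [Finite M]
    (hk : Nat.card M ≤ k) :
    ∃ l : List (Ideal R), (∀ P ∈ l, IsFinitePrimitive P) ∧
      ∀ r : R, (r : D) ∈ R.idealProd l → ∀ x : M, r • x = 0 := by
  induction k generalizing M with
  | zero => exact absurd Nat.card_pos hk.not_gt
  | succ k ih =>
    rcases subsingleton_or_nontrivial M with hM | hM
    · exact ⟨[], by simp, fun r _ x => Subsingleton.elim _ _⟩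
    have : Finite (Submodule R M) := Finite.of_injective _ SetLike.coe_injective
    -- A product killing `M ⧸ B` sends `M` into the simple submodule `B`, which `Ann B`, placed
    -- leftmost, then kills.
    obtain ⟨B, hB, -⟩ := (eq_bot_or_exists_atom_le (⊤ : Submodule R M)).resolve_left
      (by simp)
    have hBs : IsSimpleModule R B := isSimpleModule_iff_isAtom.2 hB
    obtain ⟨m, hm, ⟨e⟩⟩ := isSimpleModule_iff_quot_maximal.1 hBs
    have := IsSimpleModule.nontrivial R B
    have : Finite (M ⧸ B) := Finite.of_surjective B.mkQ B.mkQ_surjective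
    have hcard : Nat.card (M ⧸ B) ≤ k := by
      have h1 := B.card_eq_card_quotient_mul_card
      have h2 : 1 < Nat.card B := Finite.one_lt_card
      have h3 : 0 < Nat.card (M ⧸ B) := Nat.card_pos
      nlinarith
    obtain ⟨l, hl, hlM⟩ := ih (M ⧸ B) hcard
    refine ⟨Module.annihilator R B :: l, ?_, ?_⟩
    · simp only [List.mem_cons, forall_eq_or_imp]
      exact ⟨⟨m, hm.out, Finite.of_equiv _ e.toEquiv, e.annihilator_eq⟩, hl⟩
    · suffices h : ∀ x ∈ R.idealProd (Module.annihilator R B :: l),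
          ∀ h : x ∈ R, ∀ y : M, (⟨x, h⟩ : R) • y = 0 from fun r hr x => h r hr r.2 x
      intro x hx
      rw [idealProd_cons] at hx
      induction hx using Submodule.mul_induction_on' with
      | mem_mul_mem p hp y hy =>
        intro h z
        obtain ⟨hpR, hp⟩ := mem_idealLattice.1 hp
        have hyR := idealProd_le l hy
        have hyz : (⟨y, hyR⟩ : R) • z ∈ B := by
          rw [← Submodule.Quotient.mk_eq_zero, Submodule.Quotient.mk_smul]
          exact hlM ⟨y, hyR⟩ hy _
        have := congrArg Subtype.val (Module.mem_annihilator.1 hp ⟨_, hyz⟩)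
        have h' : (⟨p * y, h⟩ : R) = ⟨p, hpR⟩ * ⟨y, hyR⟩ := rfl
        rw [h', mul_smul]
        exact this
      | add x hx y hy ihx ihy =>
        intro h z
        rw [← idealProd_cons] at hx hy
        have h' : (⟨x + y, h⟩ : R) = ⟨x, idealProd_le _ hx⟩ + ⟨y, idealProd_le _ hy⟩ := rfl
        rw [h', add_smul, ihx, ihy, add_zero]

/-- Dual basis: if `1 = ∑ xᵢ yᵢ`, then `q = ∑ (q xᵢ) yᵢ` with coordinates `q xᵢ ∈ R`. Replacing `1`
by any `z` allows induction on sums. -/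
theorem projective_of_one_mem (Q : Ideal R) (X : Submodule ℤ D)
    (hX : ∀ x ∈ X, ∀ q ∈ R.idealLattice Q, q * x ∈ R) (h : 1 ∈ X * R.idealLattice Q) :
    Module.Projective R Q := by
  suffices key : ∀ z ∈ X * R.idealLattice Q, ∃ (k : ℕ) (f : Q →ₗ[R] (Fin k → R))
      (g : (Fin k → R) →ₗ[R] Q), ∀ q, ((g (f q) : R) : D) = (q : R) * z by
    obtain ⟨k, f, g, hfg⟩ := key 1 h
    refine Module.Projective.of_split f g ?_
    ext q
    simpa using hfg q
  intro z hz
  induction hz using Submodule.mul_induction_on' with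
  | mem_mul_mem x hx y hy =>
    obtain ⟨hyR, hy⟩ := mem_idealLattice.1 hy
    let f : Q →ₗ[R] (Fin 1 → R) :=
      { toFun := fun q _ => ⟨(q : R) * x, hX x hx _ (coe_mem_idealLattice.2 q.2)⟩
        map_add' := fun p q => by ext; simp [add_mul]
        map_smul' := fun r q => by ext; simp [mul_assoc] }
    refine ⟨1, f, (LinearMap.toSpanSingleton R Q ⟨_, hy⟩) ∘ₗ LinearMap.proj 0, fun q => ?_⟩
    simp [f, mul_assoc]
  | add y _ z _ hy hz =>
    obtain ⟨k, f, g, hy⟩ := hy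
    obtain ⟨k', f', g', hz⟩ := hz
    let e := (LinearEquiv.funCongrLeft R R (finSumFinEquiv (m := k) (n := k'))).trans
      (LinearEquiv.sumArrowLequivProdArrow (Fin k) (Fin k') R R)
    refine ⟨k + k', e.symm.toLinearMap ∘ₗ f.prod f', (g.coprod g') ∘ₗ e.toLinearMap, fun q => ?_⟩
    simp [hy, hz, mul_add]

end Lattice

end Subring

/-! ### Orders, multiplier rings, and invertibility of finite primitive ideals. -/

namespace Subring

section Order

variable {D : Type*} [DivisionRing D] [Algebra ℚ D] {R S : Subring D}

theorem IsOrder.finite_int (hR : R.IsOrder) : Module.Finite ℤ R :=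
  Module.Finite.iff_addGroup_fg.2 ((AddGroup.fg_iff_addSubgroup_fg R.toAddSubgroup).2 hR.fg)

theorem IsOrder.isNoetherian_int (hR : R.IsOrder) : IsNoetherian ℤ R :=
  have := hR.finite_int
  inferInstance

theorem IsOrder.isNoetherianRing (hR : R.IsOrder) : IsNoetherianRing R :=
  have := hR.isNoetherian_int
  isNoetherian_of_tower ℤ this

theorem IsOrder.exists_int_mul_mem (hR : R.IsOrder) (x : D) :
    ∃ n : ℤ, n ≠ 0 ∧ (n : D) * x ∈ R := by
  have hx : x ∈ Submodule.span ℚ (R : Set D) := hR.span_eq_top ▸ Submodule.mem_top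
  induction hx using Submodule.span_induction with
  | mem x hx => exact ⟨1, one_ne_zero, by simpa using hx⟩
  | zero => exact ⟨1, one_ne_zero, by simp⟩
  | add x y _ _ hx hy =>
    obtain ⟨n, hn, hx⟩ := hx
    obtain ⟨k, hk, hy⟩ := hy
    refine ⟨k * n, mul_ne_zero hk hn, ?_⟩
    have h : ((k * n : ℤ) : D) * (x + y) = k * (n * x) + n * (k * y) := by
      rw [← mul_assoc, ← mul_assoc, ← Int.cast_mul, ← Int.cast_mul, mul_comm n k, mul_add]
    rw [h]
    exact R.add_mem (R.mul_mem (intCast_mem R _) hx) (R.mul_mem (intCast_mem R _) hy)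
  | smul q x _ hx =>
    obtain ⟨n, hn, hx⟩ := hx
    refine ⟨q.den * n, mul_ne_zero (by exact_mod_cast q.den_ne_zero) hn, ?_⟩
    have h : ((q.den * n : ℤ) : D) * (q • x) = q.num * (n * x) := by
      rw [← mul_assoc, ← Int.cast_mul, ← zsmul_eq_mul, ← zsmul_eq_mul, ← Int.cast_smul_eq_zsmul ℚ,
        ← Int.cast_smul_eq_zsmul ℚ, smul_smul]
      congr 1
      push_cast
      rw [mul_right_comm, mul_comm (q.den : ℚ), Rat.mul_den_eq_num]
    rw [h]
    exact R.mul_mem (intCast_mem R _) hx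

theorem IsOrder.exists_mul_eq_int (hR : R.IsOrder) {a : R} (ha : a ≠ 0) :
    ∃ (b : R) (n : ℤ), n ≠ 0 ∧ b * a = n := by
  obtain ⟨n, hn, h⟩ := hR.exists_int_mul_mem (a : D)⁻¹
  refine ⟨⟨_, h⟩, n, hn, Subtype.ext ?_⟩
  simp [mul_assoc, inv_mul_cancel₀ (fun h => ha (Subtype.ext h) : (a : D) ≠ 0)]

theorem IsOrder.of_le (hR : R.IsOrder) (hRS : R ≤ S) {n : ℤ} (hn : n ≠ 0)
    (h : ∀ x ∈ S, (n : D) * x ∈ R) : S.IsOrder where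
  fg := by
    have := algebraRat.charZero D
    have := hR.isNoetherian_int
    let f : S →+ R :=
      { toFun := fun x => ⟨n * x, h x x.2⟩
        map_zero' := by ext; simp
        map_add' := fun x y => by ext; simp [mul_add] }
    have hf : Function.Injective f.toIntLinearMap := fun x y hxy => by
      have := congrArg Subtype.val hxy
      exact Subtype.ext (mul_left_cancel₀ (Int.cast_ne_zero.2 hn) this)
    have : Module.Finite ℤ S := Module.Finite.of_injective _ hf
    exact (AddGroup.fg_iff_addSubgroup_fg S.toAddSubgroup).1 (Module.Finite.iff_addGroup_fg.1 this)
  span_eq_top := top_le_iff.1 (hR.span_eq_top ▸ Submodule.span_mono hRS)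

/-- The left multiplier ring of `I` contains `R`, and `n` carries it into `I ⊆ R`; so it is an
order, and maximality makes it `R`. -/
theorem IsMaximalOrder.mem_of_mul_mem (hR : R.IsMaximalOrder) (I : Submodule ℤ D)
    (hI : ∀ x ∈ I, x ∈ R) (hRI : ∀ r ∈ R, ∀ x ∈ I, r * x ∈ I) {n : ℤ} (hn : n ≠ 0)
    (hnI : (n : D) ∈ I) {x : D} (hx : ∀ y ∈ I, x * y ∈ I) : x ∈ R := by
  let S : Subring D :=
    { carrier := {x | ∀ y ∈ I, x * y ∈ I}
      mul_mem' := fun {a b} ha hb y hy => by rw [mul_assoc]; exact ha _ (hb _ hy)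
      one_mem' := fun y hy => by rwa [one_mul]
      add_mem' := fun {a b} ha hb y hy => by rw [add_mul]; exact add_mem (ha _ hy) (hb _ hy)
      zero_mem' := fun y hy => by rw [zero_mul]; exact zero_mem _
      neg_mem' := fun {a} ha y hy => by rw [neg_mul]; exact neg_mem (ha _ hy) }
  have hRS : R ≤ S := fun r hr y hy => hRI r hr y hy
  have hS : S.IsOrder := hR.1.of_le hRS hn fun y hy => by
    rw [Int.cast_comm]
    exact hI _ (hy _ hnI)
  rw [← hR.2 S hS hRS]
  exact hx

theorem IsMaximalOrder.mem_of_mem_mul (hR : R.IsMaximalOrder) (I : Submodule ℤ D)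
    (hI : ∀ x ∈ I, x ∈ R) (hIR : ∀ r ∈ R, ∀ x ∈ I, x * r ∈ I) {n : ℤ} (hn : n ≠ 0)
    (hnI : (n : D) ∈ I) {x : D} (hx : ∀ y ∈ I, y * x ∈ I) : x ∈ R := by
  let S : Subring D :=
    { carrier := {x | ∀ y ∈ I, y * x ∈ I}
      mul_mem' := fun {a b} ha hb y hy => by rw [← mul_assoc]; exact hb _ (ha _ hy)
      one_mem' := fun y hy => by rwa [mul_one]
      add_mem' := fun {a b} ha hb y hy => by rw [mul_add]; exact add_mem (ha _ hy) (hb _ hy)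
      zero_mem' := fun y hy => by rw [mul_zero]; exact zero_mem _
      neg_mem' := fun {a} ha y hy => by rw [mul_neg]; exact neg_mem (ha _ hy) }
  have hRS : R ≤ S := fun r hr y hy => hIR r hr y hy
  have hS : S.IsOrder := hR.1.of_le hRS hn fun y hy => hI _ (hy _ hnI)
  rw [← hR.2 S hS hRS]
  exact hx

theorem IsOrder.finite_of_int_smul_eq_zero (hR : R.IsOrder) {M : Type*} [AddCommGroup M]
    [Module R M] [Module.Finite R M] {n : ℤ} (hn : n ≠ 0) (h : ∀ x : M, n • x = 0) : Finite M := by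
  have := hR.finite_int
  have : Module.Finite ℤ M := Module.Finite.trans R M
  exact Module.finite_of_fg_torsion M fun x =>
    ⟨⟨n, mem_nonZeroDivisors_of_ne_zero hn⟩, h x⟩

/-- If all `x` with `x * Q ⊆ R` lie in `R`, then `A * Q * B ⊆ n * R` implies `B * A ⊆ n * R`. -/
theorem IsMaximalOrder.idealProd_rotate (hR : R.IsMaximalOrder) {Q : Ideal R}
    (hQ : ∀ x : D, (∀ q ∈ R.idealLattice Q, x * q ∈ R) → x ∈ R) {n : ℤ} (s t : List (Ideal R))
    (ht : ∀ P ∈ t, ∃ n : ℤ, n ≠ 0 ∧ (n : R) ∈ P)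
    (h : ∀ x ∈ R.idealProd (s ++ Q :: t), (n : D)⁻¹ * x ∈ R) :
    ∀ x ∈ R.idealProd (t ++ s), (n : D)⁻¹ * x ∈ R := by
  have := algebraRat.charZero D
  intro x hx
  have hcomm : ∀ y : D, (n : D)⁻¹ * y = y * (n : D)⁻¹ := fun y =>
    ((Int.cast_commute n y).inv_left₀).eq
  obtain ⟨k, hk, hkt⟩ := exists_int_mem_idealProd t ht
  rw [idealProd_append] at hx
  induction hx using Submodule.mul_induction_on' with
  | add x _ y _ hx hy => rw [mul_add]; exact R.add_mem hx hy
  | mem_mul_mem b hb a ha =>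
    -- It suffices that `n⁻¹ b a q` multiplies `B` into itself, as then it lies in `R`. Indeed `n⁻¹
    -- a q b' ∈ R`, and `B` is stable under right multiplication by `R`.
    refine hQ _ fun q hq => ?_
    refine hR.mem_of_mul_mem (R.idealProd t) (fun _ => idealProd_le t)
      (fun r hr y hy => mul_mem_idealProd hr hy) hk hkt fun b' hb' => ?_
    have hmem : a * (q * b') ∈ R.idealProd (s ++ Q :: t) := by
      rw [idealProd_append, idealProd_cons]
      exact Submodule.mul_mem_mul ha (Submodule.mul_mem_mul hq hb')
    have heq : (n : D)⁻¹ * (b * a) * q * b' = b * ((n : D)⁻¹ * (a * (q * b'))) := by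
      rw [← mul_assoc b, ← hcomm b]
      simp only [mul_assoc]
    rw [heq]
    exact idealProd_mul_mem hb (h _ hmem)

/-- The inverse of a maximal two-sided ideal of a maximal order is not contained in the order. -/
theorem IsMaximalOrder.exists_notMem_forall_mul_mem (hR : R.IsMaximalOrder) {Q : Ideal R}
    (hQ : IsFinitePrimitive Q) : ∃ x : D, (∀ q ∈ R.idealLattice Q, x * q ∈ R) ∧ x ∉ R := by
  by_contra! hX
  have := algebraRat.charZero D
  obtain ⟨n, hn, hnQ⟩ := hQ.exists_int_mem
  have hQt := hQ.isTwoSided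
  have hn' : (n : D) ≠ 0 := Int.cast_ne_zero.2 hn
  -- Descent on the length of a product contained in `n R`: such a product exists because `R ⧸ n R`
  -- is finite, and rotation always removes a factor `Q`.
  suffices key : ∀ (k : ℕ) (l : List (Ideal R)), l.length = k → (∀ P ∈ l, IsFinitePrimitive P) →
      (∀ x ∈ R.idealProd l, (n : D)⁻¹ * x ∈ R) → False by
    let I : Ideal R := Ideal.span {(n : R)}
    have : Finite (R ⧸ I) := by
      refine hR.1.finite_of_int_smul_eq_zero hn fun x => ?_
      obtain ⟨r, rfl⟩ := Submodule.Quotient.mk_surjective _ x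
      rw [← Submodule.Quotient.mk_smul, Submodule.Quotient.mk_eq_zero, zsmul_eq_mul, Int.cast_comm]
      exact I.mul_mem_left _ (Ideal.subset_span rfl)
    obtain ⟨l, hl, hlI⟩ := exists_idealProd_smul_eq_zero (R := R) _ (R ⧸ I) le_rfl
    refine key _ l rfl hl fun x hx => ?_
    lift x to R using idealProd_le l hx
    have h1 := hlI x hx (Submodule.Quotient.mk 1)
    rw [← Submodule.Quotient.mk_smul, Submodule.Quotient.mk_eq_zero, smul_eq_mul, mul_one] at h1
    obtain ⟨r, rfl⟩ := Ideal.mem_span_singleton'.1 h1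
    rw [← Int.cast_comm]
    simp [hn']
  intro k
  induction k using Nat.strong_induction_on with
  | _ k ih =>
    intro l hlk hl h
    by_cases hQl : Q ∈ l
    · obtain ⟨s, t, rfl⟩ := List.append_of_mem hQl
      refine ih _ ?_ (t ++ s) rfl (fun P hP => hl P ?_)
        (hR.idealProd_rotate hX s t (fun P hP => (hl P (by simp [hP])).exists_int_mem) h)
      · rw [← hlk]
        simp only [List.length_append, List.length_cons]
        omega
      · simp only [List.mem_append, List.mem_cons] at hP ⊢
        tauto
    -- The product lies in `n R ⊆ Q`, so some factor lies in `Q`, hence equals `Q`.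
    · obtain ⟨P, hP, hPQ⟩ := hQ.exists_mem_le l fun x hx => by
        have := idealLattice_mul_mem (P := Q) (coe_mem_idealLattice.2 hnQ) (h x hx)
        simpa [← mul_assoc, hn'] using this
      obtain ⟨m, hm, -, hQm⟩ := id hQ
      exact hQl ((hl P hP).eq_of_le hm hQm hPQ ▸ hP)

/-- With `X = Q⁻¹`, failure of `1 ∈ X Q` makes `X Q` a proper two-sided ideal containing `Q`. It
lies in the annihilator of some simple `R ⧸ m`, which must be `Q`. Then `X` multiplies `Q` into
itself, so `X ⊆ R`, a contradiction. -/
theorem IsMaximalOrder.projective_of_isFinitePrimitive (hR : R.IsMaximalOrder) {Q : Ideal R}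
    (hQ : IsFinitePrimitive Q) : Module.Projective R Q := by
  have := algebraRat.charZero D
  have hQt := hQ.isTwoSided
  obtain ⟨n, hn, hnQ⟩ := hQ.exists_int_mem
  have hnQ' : (n : D) ∈ R.idealLattice Q := by simpa using coe_mem_idealLattice.2 hnQ
  have hQR : ∀ x ∈ R.idealLattice Q, x ∈ R := fun x hx => (mem_idealLattice.1 hx).1
  -- the two descriptions of the inverse of `Q` agree
  have hswap : ∀ x : D, (∀ q ∈ R.idealLattice Q, q * x ∈ R) →
      ∀ q ∈ R.idealLattice Q, x * q ∈ R := fun x hx q hq =>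
    -- `Q x q ⊆ R q ⊆ Q` puts `x q` in the right multiplier ring of `Q`.
    hR.mem_of_mem_mul (R.idealLattice Q) hQR (fun r hr y hy => idealLattice_mul_mem hy hr) hn hnQ'
      fun y hy => by rw [← mul_assoc]; exact mul_mem_idealLattice (hx y hy) hq
  have hswap' : ∀ x : D, (∀ q ∈ R.idealLattice Q, x * q ∈ R) →
      ∀ q ∈ R.idealLattice Q, q * x ∈ R := fun x hx q hq =>
    hR.mem_of_mul_mem (R.idealLattice Q) hQR (fun r hr y hy => mul_mem_idealLattice hr hy) hn hnQ'
      fun y hy => by rw [mul_assoc]; exact idealLattice_mul_mem hq (hx y hy)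
  let X : Submodule ℤ D := AddSubgroup.toIntSubmodule
    { carrier := {x | ∀ q ∈ R.idealLattice Q, q * x ∈ R}
      add_mem' := fun {a b} ha hb q hq => by rw [mul_add]; exact R.add_mem (ha q hq) (hb q hq)
      zero_mem' := fun q hq => by rw [mul_zero]; exact R.zero_mem
      neg_mem' := fun {a} ha q hq => by rw [mul_neg]; exact R.neg_mem (ha q hq) }
  have hX : ∀ x, x ∈ X ↔ ∀ q ∈ R.idealLattice Q, q * x ∈ R := fun x => Iff.rfl
  refine projective_of_one_mem Q X (fun x hx => hx) ?_
  by_contra h1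
  -- the left ideal `X * Q` of `R`
  have hXQR : X * R.idealLattice Q ≤ R.idealLattice ⊤ := Submodule.mul_le.2 fun x hx q hq =>
    mem_idealLattice.2 ⟨hswap x hx q hq, trivial⟩
  have hXR : ∀ r ∈ R, ∀ x ∈ X, r * x ∈ X := fun r hr x hx q hq => by
    rw [← mul_assoc]; exact hx _ (idealLattice_mul_mem hq hr)
  have hRX : ∀ r ∈ R, ∀ x ∈ X * R.idealLattice Q, r * x ∈ X * R.idealLattice Q := by
    intro r hr x hx
    induction hx using Submodule.mul_induction_on' with
    | mem_mul_mem x hx q hq => rw [← mul_assoc]; exact Submodule.mul_mem_mul (hXR r hr x hx) hq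
    | add x _ y _ hx hy => rw [mul_add]; exact add_mem hx hy
  have hXRr : ∀ r ∈ R, ∀ x ∈ X * R.idealLattice Q, x * r ∈ X * R.idealLattice Q := by
    intro r hr x hx
    induction hx using Submodule.mul_induction_on' with
    | mem_mul_mem x hx q hq =>
      rw [mul_assoc]; exact Submodule.mul_mem_mul hx (idealLattice_mul_mem hq hr)
    | add x _ y _ hx hy => rw [add_mul]; exact add_mem hx hy
  let J : Ideal R :=
    { carrier := {r | (r : D) ∈ X * R.idealLattice Q}
      add_mem' := fun {a b} ha hb => (X * R.idealLattice Q).add_mem ha hb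
      zero_mem' := zero_mem (X * R.idealLattice Q)
      smul_mem' := fun r x hx => hRX r r.2 x hx }
  have hJ : J ≠ ⊤ := fun h => h1 (by
    have : (1 : R) ∈ J := h ▸ Submodule.mem_top
    exact this)
  obtain ⟨m, hm, hJm⟩ := Ideal.exists_le_maximal J hJ
  have hJann : J ≤ Module.annihilator R (R ⧸ m) := fun r hr => by
    rw [Module.mem_annihilator]
    intro x
    obtain ⟨y, rfl⟩ := Submodule.Quotient.mk_surjective _ x
    rw [← Submodule.Quotient.mk_smul, Submodule.Quotient.mk_eq_zero]
    exact hJm (hXRr y y.2 r hr)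
  have hQJ : Q ≤ J := fun q hq => by
    have : (1 : D) * q ∈ X * R.idealLattice Q := Submodule.mul_mem_mul
      (fun q hq => by rw [mul_one]; exact hQR q hq) (coe_mem_idealLattice.2 hq)
    rw [one_mul] at this
    exact this
  have hQeq := hQ.eq_of_le hm.out rfl (hQJ.trans hJann)
  obtain ⟨x, hxQ, hx⟩ := hR.exists_notMem_forall_mul_mem hQ
  refine hx (hR.mem_of_mul_mem (R.idealLattice Q) hQR (fun r hr y hy => mul_mem_idealLattice hr hy)
    hn hnQ' fun q hq => ?_)
  have hxq : x * q ∈ X * R.idealLattice Q := Submodule.mul_mem_mul (hswap' x hxQ) hq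
  refine mem_idealLattice.2 ⟨hxQ q hq, ?_⟩
  rw [hQeq]
  exact hJann hxq

end Order

end Subring

/-! ### From invertible ideals to torsion-free modules. -/

namespace Subring

/-- Over a maximal order, finitely generated torsion-free modules are projective. -/
theorem IsMaximalOrder.projective_of_smul_ne_zero {D : Type*} [DivisionRing D] [Algebra ℚ D]
    {R : Subring D} (hR : R.IsMaximalOrder) {M : Type*} [AddCommGroup M] [Module R M]
    [Module.Finite R M] (hM : ∀ (a : R) (x : M), a ≠ 0 → x ≠ 0 → a • x ≠ 0) :
    Module.Projective R M := by
  have := algebraRat.charZero D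
  have := hR.1.isNoetherianRing
  obtain ⟨s, hs, hmax⟩ := exists_maximal_linearIndepOn R (id : M → M)
  let L : Submodule R M := Submodule.span R (id '' s)
  have hfree : Module.Free R L := .of_basis (Module.Basis.span hs |>.map
    (LinearEquiv.ofEq _ _ (by simp only [L, Set.image_eq_range])))
  have htors : ∀ x : M, ∃ n : ℤ, n ≠ 0 ∧ n • x ∈ L := by
    intro x
    by_cases hx : x ∈ s
    · exact ⟨1, one_ne_zero, by rw [one_smul]; exact Submodule.subset_span ⟨x, hx, rfl⟩⟩
    obtain ⟨a, ha, hax⟩ := hmax x hx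
    -- An integer is central, unlike `a`, so multiplication by it is `R`-linear.
    obtain ⟨b, n, hn, hb⟩ := hR.1.exists_mul_eq_int ha
    refine ⟨n, hn, ?_⟩
    rw [← Int.cast_smul_eq_zsmul R, ← hb, mul_smul]
    exact L.smul_mem b hax
  obtain ⟨n, hn, hnL⟩ : ∃ n : ℤ, n ≠ 0 ∧ ∀ x : M, n • x ∈ L := by
    suffices h : ∀ N : Submodule R M, N.FG → ∃ n : ℤ, n ≠ 0 ∧ ∀ x ∈ N, n • x ∈ L by
      obtain ⟨n, hn, h⟩ := h ⊤ Module.Finite.fg_top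
      exact ⟨n, hn, fun x => h x trivial⟩
    intro N hN
    induction N, hN using Submodule.fg_induction with
    | singleton x =>
      obtain ⟨n, hn, h⟩ := htors x
      refine ⟨n, hn, fun y hy => ?_⟩
      obtain ⟨r, rfl⟩ := Submodule.mem_span_singleton.1 hy
      rw [smul_comm]
      exact L.smul_mem r h
    | sup N₁ N₂ _ _ h₁ h₂ =>
      obtain ⟨n, hn, h₁⟩ := h₁
      obtain ⟨k, hk, h₂⟩ := h₂
      refine ⟨n * k, mul_ne_zero hn hk, fun x hx => ?_⟩
      obtain ⟨y, hy, z, hz, rfl⟩ := Submodule.mem_sup.1 hx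
      rw [smul_add, mul_comm n k, mul_smul, mul_comm k n, mul_smul]
      exact add_mem (zsmul_mem (h₁ y hy) k) (zsmul_mem (h₂ z hz) n)
  let f : M →ₗ[R] L := LinearMap.codRestrict L (n • LinearMap.id) hnL
  have hf : Function.Injective f := by
    rw [← LinearMap.ker_eq_bot, LinearMap.ker_eq_bot']
    intro x hx
    by_contra hx0
    refine hM (n : R) x (Int.cast_ne_zero.2 hn) hx0 ?_
    rw [Int.cast_smul_eq_zsmul]
    exact congrArg Subtype.val hx
  -- The range is `n M`, which contains `n L`.
  have hfin : Finite (L ⧸ LinearMap.range f) := by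
    refine hR.1.finite_of_int_smul_eq_zero hn fun x => ?_
    obtain ⟨y, rfl⟩ := Submodule.Quotient.mk_surjective _ x
    rw [← Submodule.Quotient.mk_smul, Submodule.Quotient.mk_eq_zero]
    exact ⟨y, rfl⟩
  have := Module.Projective.of_finite_quotient_of_annihilator
    (fun m hm hm' => hR.projective_of_isFinitePrimitive ⟨m, hm, hm', rfl⟩) (LinearMap.range f)
  exact Module.Projective.of_equiv (LinearEquiv.ofInjective f hf).symm

end Subring

/-! ### Avoiding `N`, and the construction of `F`. -/

/-- If `G` contains a free module of infinite rank and `N` is a finitely generated submodule, then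
`G` contains free modules of arbitrary finite rank that meet `N` trivially. -/
theorem Submodule.exists_injective_fin_disjoint {R G : Type*} [Ring R] [IsNoetherianRing R]
    [AddCommGroup G] [Module R G] (H : Submodule R G) (e : H ≃ₗ[R] (ℕ →₀ R))
    (N : Submodule R G) (hN : N.FG) (k : ℕ) :
    ∃ f : (Fin k → R) →ₗ[R] G, ∀ v, f v ∈ N → v = 0 := by
  classical
  have : Module.Finite R N := Module.Finite.iff_fg.2 hN
  let N' : Submodule R (ℕ →₀ R) := (N.comap H.subtype).map e.toLinearMap
  have hN' : N'.FG := by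
    have h : (N ⊓ H).FG := by
      have := isNoetherian_of_isNoetherianRing_of_finite R N
      exact (isNoetherian_submodule.1 this) _ inf_le_left
    refine Submodule.FG.map _ (Submodule.fg_of_fg_map_injective H.subtype H.subtype_injective ?_)
    rwa [Submodule.map_comap_subtype, inf_comm]
  obtain ⟨m, hm⟩ : ∃ m : ℕ, ∀ x ∈ N', ∀ i, m ≤ i → x i = 0 := by
    obtain ⟨T, hT⟩ := hN'
    refine ⟨T.sup (fun x => x.support.sup Nat.succ), fun x hx i hi => ?_⟩
    rw [← hT] at hx
    induction hx using Submodule.span_induction with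
    | mem x hx =>
      by_contra h
      have h1 := Finset.le_sup (f := Nat.succ) (Finsupp.mem_support_iff.2 h)
      have h2 := Finset.le_sup (f := fun x : ℕ →₀ R => x.support.sup Nat.succ) hx
      exact absurd (h1.trans (h2.trans hi)) (Nat.not_succ_le_self i)
    | zero => rfl
    | add x y _ _ hx hy => simp [hx, hy]
    | smul r x _ hx => simp [hx]
  -- The basis vectors used start at `m`, beyond all supports in `N'`.
  let j : Fin k → ℕ := fun i => m + i
  have hj : Function.Injective j := fun a b h => Fin.ext (Nat.add_left_cancel h)
  refine ⟨H.subtype ∘ₗ e.symm.toLinearMap ∘ₗ Finsupp.lmapDomain R R j ∘ₗ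
    (Finsupp.linearEquivFunOnFinite R R (Fin k)).symm.toLinearMap, fun v hv => ?_⟩
  ext i
  have := hm (Finsupp.mapDomain j ((Finsupp.linearEquivFunOnFinite R R (Fin k)).symm v))
    ⟨_, hv, by simp⟩ (j i) (Nat.le_add_right _ _)
  rw [Finsupp.mapDomain_apply hj] at this
  simpa using this

theorem mainTheorem9 {D : Type*} [DivisionRing D] [Algebra ℚ D] [FiniteDimensional ℚ D]
    (R : Subring D) (hR : R.IsMaximalOrder)
    {G : Type*} [AddCommGroup G] [Module R G]
    (hG : ∃ H : Submodule R G, Nonempty (H ≃ₗ[R] (ℕ →₀ R)))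
    (M N : Submodule R G) (hMN : M ≤ N)
    (hMfg : M.FG) (hNfg : N.FG)
    (hMtf : ∀ (a : R) (x : M), a ≠ 0 → x ≠ 0 → a • x ≠ 0)
    (hNtf : ∀ (a : R) (x : N), a ≠ 0 → x ≠ 0 → a • x ≠ 0) :
    ∃ F : Submodule R G, F.FG ∧ Module.Free R F ∧ F ⊓ N = M := by
  have := hR.1.isNoetherianRing
  have : Module.Finite R M := Module.Finite.iff_fg.2 hMfg
  have : Module.Projective R M := hR.projective_of_smul_ne_zero hMtf
  obtain ⟨k, s, i, -, -, hsi⟩ := Module.Finite.exists_comp_eq_id_of_projective R M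
  have hsi' : ∀ x, s (i x) = x := fun x => LinearMap.congr_fun hsi x
  obtain ⟨H, ⟨e⟩⟩ := hG
  obtain ⟨f, hf⟩ := H.exists_injective_fin_disjoint e N hNfg k
  -- `g` is `s` on the copy `i M` of `M` and `f` on `ker s`. Since `s v ∈ N`, `g v ∈ N` forces the
  -- `f` term into `N`, so `v = i (s v)`.
  let g : (Fin k → R) →ₗ[R] G := M.subtype ∘ₗ s + f ∘ₗ (LinearMap.id - i ∘ₗ s)
  have hg : ∀ v, g v = s v + f (v - i (s v)) := fun v => rfl
  have hgN : ∀ v, g v ∈ N → v = i (s v) := fun v hv => by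
    rw [hg, Submodule.add_mem_iff_right _ (hMN (s v).2)] at hv
    exact sub_eq_zero.1 (hf _ hv)
  have hginj : Function.Injective g := by
    rw [← LinearMap.ker_eq_bot, LinearMap.ker_eq_bot']
    intro v hv
    have h := hgN v (hv ▸ N.zero_mem)
    rw [hg, ← h, sub_self, map_zero, add_zero, ZeroMemClass.coe_eq_zero] at hv
    rw [h, hv, map_zero]
  refine ⟨LinearMap.range g, Module.Finite.iff_fg.1 inferInstance,
    Module.Free.of_equiv (LinearEquiv.ofInjective g hginj), le_antisymm ?_ ?_⟩
  · rintro _ ⟨⟨v, rfl⟩, hv⟩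
    rw [hg, ← hgN v hv, sub_self, map_zero, add_zero]
    exact (s v).2
  · intro x hx
    refine ⟨⟨i ⟨x, hx⟩, ?_⟩, hMN hx⟩
    rw [hg, hsi', sub_self, map_zero, add_zero]
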